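/- Let $n\in\mathbb N$, let $\mathcal G$ be a compact topological group (for instance a compact Lie group) and let $U:\mathcal G\to \mathrm U(n)\subset\mathbb M_n(\mathbb C)$ be a continuous unitary representation. A linear map $\phi$ on $\mathbb M_n(\mathbb C)$ is called - completely positive (CP) if for every $k$ the map $[a_{ij}]\mapsto[\phi(a_{ij})]$ on $\mathbb M_k(\mathbb M_n(\mathbb C))$ is positive, and completely copositive if $A\mapsto\phi(A)^{\mathsf T}$ is CP; - decomposable if $\phi=\phi_1+\phi_2$ with $\phi_1$ CP and $\phi_2$ completely copositive; - trace preserving if $\operatorname{tr}\phi(A)=\operatorname{tr}A$ for all $A$; - $U$-covariant if $\phi\big(U(g)AU(g)^{*}\big)=U(g)\phi(A)U(g)^{*}$ for all $g\in\mathcal G$ and $A\in\mathbb M_n(\mathbb C)$. Let $\phi^{\dagger}$ denote the dual map, determined by $\operatorname{tr}(A\,\phi(T))=\operatorname{tr}(\phi^{\dagger}(A)\,T)$ for all $A,T$. Let $L$ be a linear map on $\mathbb M_n(\mathbb C)$ that generates a semigroup of decomposable trace preserving maps, i.e. $e^{tL}$ is decomposable and trace preserving for every $t\ge 0$. Then $L$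 is $U$-covariant if and only if there exist a Hermitian matrix $H\in U(\mathcal G)'$ (that is, $HU(g)=U(g)H$ for all $g\in\mathcal G$) and a $U$-covariant decomposable map $\varphi$ on $\mathbb M_n(\mathbb C)$ such that, for all $A\in\mathbb M_n(\mathbb C)$, $$L(A)=-i\,[H,A]+\varphi(A)-\tfrac12\big\{\varphi^{\dagger}(I),A\big\}.$$ -/

import Mathlib

namespace CovariantDecomposable

section Definitions

-- `Matrix (Fin n) (Fin n) ℂ` as a C⋆-algebra: operator norm, and the order with
-- `0 ≤ A` iff `A` is positive semidefinite.
open scoped Matrix Matrix.Norms.L2Operator MatrixOrder CStarAlgebra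

variable {n : ℕ}

/-- `φ` is completely positive (Mathlib's notion, for the C⋆-algebra of `n × n` matrices). -/
def IsCP (φ : Module.End ℂ (Matrix (Fin n) (Fin n) ℂ)) : Prop :=
  ∃ f : Matrix (Fin n) (Fin n) ℂ →CP Matrix (Fin n) (Fin n) ℂ, f.toLinearMap = φ

/-- `φ` is completely copositive: transposition composed with `φ` is completely positive. -/
def IsCoCP (φ : Module.End ℂ (Matrix (Fin n) (Fin n) ℂ)) : Prop :=
  IsCP ((Matrix.transposeLinearEquiv (Fin n) (Fin n) ℂ ℂ).toLinearMap ∘ₗ φ)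

/-- `φ` is decomposable: the sum of a completely positive and a completely copositive map. -/
def IsDecomposable (φ : Module.End ℂ (Matrix (Fin n) (Fin n) ℂ)) : Prop :=
  ∃ φ₁ φ₂ : Module.End ℂ (Matrix (Fin n) (Fin n) ℂ), IsCP φ₁ ∧ IsCoCP φ₂ ∧ φ = φ₁ + φ₂

/-- `φ` preserves the trace. -/
def IsTracePreserving (φ : Module.End ℂ (Matrix (Fin n) (Fin n) ℂ)) : Prop :=
  ∀ A, (φ A).trace = A.trace

/-- The map `e^{tL}`, the exponential being taken in the Banach algebra of bounded linear maps
on the `n × n` matrices. -/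
noncomputable def semigroup (L : Module.End ℂ (Matrix (Fin n) (Fin n) ℂ)) (t : ℝ) :
    Module.End ℂ (Matrix (Fin n) (Fin n) ℂ) :=
  (NormedSpace.exp (t • LinearMap.toContinuousLinearMap L)).toLinearMap

/-- `L` generates a semigroup `(e^{tL})_{t ≥ 0}` of decomposable trace preserving maps. -/
def GeneratesDecomposableTPSemigroup (L : Module.End ℂ (Matrix (Fin n) (Fin n) ℂ)) : Prop :=
  ∀ t : ℝ, 0 ≤ t → IsDecomposable (semigroup L t) ∧ IsTracePreserving (semigroup L t)

/-- The dual map `φ†`, given by `tr (A φ(T)) = tr (φ†(A) T)`, through its matrix entries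
`φ†(A) j i = tr (φ†(A) E_ij) = tr (A φ(E_ij))`. See `trace_dualMap_mul`. -/
noncomputable def dualMap (φ : Module.End ℂ (Matrix (Fin n) (Fin n) ℂ)) :
    Module.End ℂ (Matrix (Fin n) (Fin n) ℂ) where
  toFun A := Matrix.of fun j i => (A * φ (Matrix.single i j 1)).trace
  map_add' A B := by ext; simp [add_mul]
  map_smul' c A := by ext; simp

theorem trace_dualMap_mul (φ : Module.End ℂ (Matrix (Fin n) (Fin n) ℂ))
    (A T : Matrix (Fin n) (Fin n) ℂ) : (dualMap φ A * T).trace = (A * φ T).trace := by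
  conv_rhs => rw [Matrix.matrix_eq_sum_single T]
  simp only [map_sum, Matrix.mul_sum, Matrix.trace_sum]
  rw [Finset.sum_comm]
  simp only [Matrix.trace, Matrix.diag_apply, Matrix.mul_apply, dualMap, LinearMap.coe_mk,
    AddHom.coe_mk, Matrix.of_apply]
  refine Finset.sum_congr rfl fun j _ => Finset.sum_congr rfl fun i _ => ?_
  have h : Matrix.single i j (T i j) = T i j • Matrix.single i j (1 : ℂ) := by simp
  rw [h, map_smul]
  simp only [Matrix.smul_apply, smul_eq_mul, Finset.sum_mul]
  refine Finset.sum_congr rfl fun k _ => Finset.sum_congr rfl fun l _ => by ring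

variable {G : Type*} [Group G]

/-- `φ` is `U`-covariant: `φ ∘ Ad_{U(g)} = Ad_{U(g)} ∘ φ` for all `g`, with
`Ad_{U(g)}(A) = U(g) A U(g)ᴴ`. -/
def IsCovariant (U : G →* Matrix.unitaryGroup (Fin n) ℂ)
    (φ : Module.End ℂ (Matrix (Fin n) (Fin n) ℂ)) : Prop :=
  ∀ (g : G) (A : Matrix (Fin n) (Fin n) ℂ),
    φ ((U g : Matrix (Fin n) (Fin n) ℂ) * A * (U g : Matrix (Fin n) (Fin n) ℂ)ᴴ) =
      (U g : Matrix (Fin n) (Fin n) ℂ) * φ A * (U g : Matrix (Fin n) (Fin n) ℂ)ᴴ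

/-- `L = -i[H, ·] + φ - ½ {φ†(I), ·}`. -/
def HasForm (L : Module.End ℂ (Matrix (Fin n) (Fin n) ℂ)) (H : Matrix (Fin n) (Fin n) ℂ)
    (φ : Module.End ℂ (Matrix (Fin n) (Fin n) ℂ)) : Prop :=
  ∀ A : Matrix (Fin n) (Fin n) ℂ,
    L A = -Complex.I • (H * A - A * H) + φ A
      - (1 / 2 : ℂ) • (dualMap φ 1 * A + A * dualMap φ 1)

end Definitions

end CovariantDecomposable

/-! Work with Choi matrices: decomposable maps correspond to `X + partialTranspose Y` with `X`, `Y`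
positive semidefinite. Let `P` project onto the complement of the maximally entangled vector `Ω`.
The identity map has Choi matrix `ΩΩᴴ`, which `P` kills, so the compression of `choi L` by `P` is a
limit of points `X + P * partialTranspose Y * P`. These form a closed cone, because the trace of the
compression controls that of `Y` (`le_re_trace_complProj_compression`). Hence `choi L` differs from
the Choi matrix of a decomposable map by a Hermitian matrix with zero compression. Such a matrix is
the Choi matrix of some `A ↦ K A + A Kᴴ`, so `L - dissipation K` is decomposable.

The admissible `K` form a closed convex set. If `L` is covariant, conjugation by each `U g`
preserves this set and the Hilbert-Schmidt norm, so the unique element of least norm commutes with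
the representation. The skew-Hermitian part of this `K` gives `H`; its Hermitian part is `-φ†(I)/2`,
since `L` annihilates the trace. The converse is a direct check. -/

namespace CovariantDecomposable

/-! ### Choi matrices of completely positive and decomposable maps. -/

section Choi

open scoped Matrix Matrix.Norms.L2Operator MatrixOrder CStarAlgebra ComplexOrder

variable {n : ℕ}

/-- The Choi matrix of `φ`, with entries `φ(E_ij)_ab` at position `((i, a), (j, b))`. -/
noncomputable def choi : Module.End ℂ (Matrix (Fin n) (Fin n) ℂ) →ₗ[ℂ]
    Matrix (Fin n × Fin n) (Fin n × Fin n) ℂ where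
  toFun φ := Matrix.of fun p q => φ (Matrix.single p.1 q.1 1) p.2 q.2
  map_add' φ ψ := by ext; simp
  map_smul' c φ := by ext; simp

theorem choi_apply (φ : Module.End ℂ (Matrix (Fin n) (Fin n) ℂ)) (p q : Fin n × Fin n) :
    choi φ p q = φ (Matrix.single p.1 q.1 1) p.2 q.2 := rfl

theorem apply_eq_sum_choi (φ : Module.End ℂ (Matrix (Fin n) (Fin n) ℂ))
    (A : Matrix (Fin n) (Fin n) ℂ) (a b : Fin n) :
    φ A a b = ∑ i, ∑ j, A i j * choi φ (i, a) (j, b) := by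
  conv_lhs => rw [Matrix.matrix_eq_sum_single A]
  simp only [map_sum, Matrix.sum_apply, choi_apply]
  refine Finset.sum_congr rfl fun i _ => Finset.sum_congr rfl fun j _ => ?_
  have h : Matrix.single i j (A i j) = A i j • Matrix.single i j (1 : ℂ) := by simp
  rw [h, map_smul, Matrix.smul_apply, smul_eq_mul]

/-- The map with a given Choi matrix. -/
noncomputable def ofChoi (C : Matrix (Fin n × Fin n) (Fin n × Fin n) ℂ) :
    Module.End ℂ (Matrix (Fin n) (Fin n) ℂ) where
  toFun A := Matrix.of fun a b => ∑ i, ∑ j, A i j * C (i, a) (j, b)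
  map_add' A B := by ext; simp [add_mul, Finset.sum_add_distrib]
  map_smul' c A := by ext; simp [Finset.mul_sum, mul_assoc]

theorem choi_ofChoi (C : Matrix (Fin n × Fin n) (Fin n × Fin n) ℂ) : choi (ofChoi C) = C := by
  ext ⟨i, a⟩ ⟨j, b⟩
  simp [choi_apply, ofChoi, Matrix.single_apply, ite_and]

theorem choi_injective : Function.Injective (choi (n := n)) := by
  intro φ ψ h
  ext A a b : 3
  rw [apply_eq_sum_choi, apply_eq_sum_choi, h]

theorem posSemidef_iff_exists_conjTranspose_mul_self {m : Type*} [Fintype m] {M : Matrix m m ℂ} :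
    M.PosSemidef ↔ ∃ B : Matrix m m ℂ, M = Bᴴ * B := by
  classical
  refine ⟨fun h => ?_, ?_⟩
  · obtain ⟨B, rfl⟩ := CStarAlgebra.nonneg_iff_eq_star_mul_self.mp h.nonneg
    exact ⟨B, rfl⟩
  · rintro ⟨B, rfl⟩
    exact Matrix.posSemidef_conjTranspose_mul_self B

/-- Positive elements are sums of `star B * B`, and flattening blocks respects products and
adjoints. -/
theorem posSemidef_flatten {k : ℕ}
    {M : CStarMatrix (Fin k) (Fin k) (Matrix (Fin n) (Fin n) ℂ)} (h : 0 ≤ M) :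
    (Matrix.of fun p q : Fin k × Fin n => M p.1 q.1 p.2 q.2).PosSemidef := by
  rw [StarOrderedRing.nonneg_iff] at h
  induction h using AddSubmonoid.closure_induction with
  | mem M hM =>
    obtain ⟨B, rfl⟩ := hM
    convert Matrix.posSemidef_conjTranspose_mul_self
      (Matrix.of fun p q : Fin k × Fin n => B p.1 q.1 p.2 q.2) using 1
    ext ⟨i, a⟩ ⟨j, b⟩
    simp only [Matrix.of_apply]
    rw [CStarMatrix.mul_apply, Matrix.sum_apply, Matrix.mul_apply, Fintype.sum_prod_type]
    refine Finset.sum_congr rfl fun k _ => ?_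
    rw [Matrix.mul_apply]
    refine Finset.sum_congr rfl fun c _ => ?_
    simp [CStarMatrix.star_apply]
  | zero => exact Matrix.PosSemidef.zero
  | add M N _ _ hM hN => exact hM.add hN

theorem IsCP.posSemidef_choi {φ : Module.End ℂ (Matrix (Fin n) (Fin n) ℂ)} (h : IsCP φ) :
    (choi φ).PosSemidef := by
  obtain ⟨f, rfl⟩ := h
  rcases isEmpty_or_nonempty (Fin n) with hn | ⟨⟨l⟩⟩
  · convert Matrix.PosSemidef.zero using 1
    exact Subsingleton.elim _ _
  -- Only row `l` of `N` is nonzero, and `E_liᴴ E_lj = E_ij`; so the block matrix of matrix units is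
  -- `star N * N`, hence positive.
  let N : CStarMatrix (Fin n) (Fin n) (Matrix (Fin n) (Fin n) ℂ) :=
    CStarMatrix.ofMatrix (Matrix.of fun i j => if i = l then Matrix.single l j 1 else 0)
  have hN : ∀ i j, (star N * N) i j = Matrix.single i j 1 := by
    intro i j
    rw [CStarMatrix.mul_apply, Finset.sum_eq_single l]
    · simp [N, CStarMatrix.star_apply, Matrix.star_eq_conjTranspose]
    · intro k _ hk
      simp [N, CStarMatrix.star_apply, hk]
    · simp
  have h := f.map_cstarMatrix_nonneg' n (star N * N) (star_mul_self_nonneg N)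
  have hC : choi f.toLinearMap =
      Matrix.of fun p q => ((star N * N).map f.toLinearMap) p.1 q.1 p.2 q.2 := by
    ext p q
    rw [Matrix.of_apply, CStarMatrix.map_apply, hN, choi_apply]
  rw [hC]
  exact posSemidef_flatten h

theorem isCP_of_eq_sum {ι : Type*} [Fintype ι] {φ : Module.End ℂ (Matrix (Fin n) (Fin n) ℂ)}
    (V : ι → Matrix (Fin n) (Fin n) ℂ) (h : ∀ A, φ A = ∑ p, V p * A * (V p)ᴴ) : IsCP φ := by
  refine ⟨⟨φ, fun k M hM => ?_⟩, rfl⟩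
  let D : ι → CStarMatrix (Fin k) (Fin k) (Matrix (Fin n) (Fin n) ℂ) := fun p =>
    CStarMatrix.ofMatrix (Matrix.diagonal fun _ => V p)
  have hD : M.map φ = ∑ p, D p * M * star (D p) := by
    have hsum : ∀ i j, (∑ p, D p * M * star (D p)) i j = ∑ p, (D p * M * star (D p)) i j := by
      intro i j
      exact Matrix.sum_apply i j _ (fun p => (D p * M * star (D p) : Matrix _ _ _))
    ext1 i j
    rw [CStarMatrix.map_apply, h, hsum]
    refine Finset.sum_congr rfl fun p _ => ?_
    simp [CStarMatrix.mul_apply, D, CStarMatrix.star_apply, Matrix.diagonal_apply,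
      Matrix.star_eq_conjTranspose, apply_ite]
  rw [hD]
  exact Finset.sum_nonneg fun p _ => star_right_conjugate_nonneg hM _

/-- Kraus operators: with `choi φ = Bᴴ * B`, each row of `B`, conjugated and reshaped, is one of
them. -/
theorem exists_eq_sum_of_posSemidef_choi {φ : Module.End ℂ (Matrix (Fin n) (Fin n) ℂ)}
    (h : (choi φ).PosSemidef) : ∃ V : Fin n × Fin n → Matrix (Fin n) (Fin n) ℂ,
      ∀ A, φ A = ∑ p, V p * A * (V p)ᴴ := by
  obtain ⟨B, hB⟩ := posSemidef_iff_exists_conjTranspose_mul_self.mp h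
  refine ⟨fun p => Matrix.of fun a i => star (B p (i, a)), fun A => ?_⟩
  ext a b
  rw [apply_eq_sum_choi, hB]
  simp only [Matrix.sum_apply, Matrix.mul_apply, Matrix.conjTranspose_apply, Matrix.of_apply,
    star_star, Finset.mul_sum, Finset.sum_mul]
  rw [Finset.sum_comm]
  simp_rw [Finset.sum_comm (s := (Finset.univ : Finset (Fin n)))
    (t := (Finset.univ : Finset (Fin n × Fin n)))]
  refine Finset.sum_congr rfl fun p _ => Finset.sum_congr rfl fun j _ =>
    Finset.sum_congr rfl fun i _ => by ring

theorem isCP_iff_posSemidef_choi {φ : Module.End ℂ (Matrix (Fin n) (Fin n) ℂ)} :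
    IsCP φ ↔ (choi φ).PosSemidef := by
  refine ⟨IsCP.posSemidef_choi, fun h => ?_⟩
  obtain ⟨V, hV⟩ := exists_eq_sum_of_posSemidef_choi h
  exact isCP_of_eq_sum V hV

/-- Partial transposition on the second tensor factor. -/
def partialTranspose : Matrix (Fin n × Fin n) (Fin n × Fin n) ℂ →ₗ[ℂ]
    Matrix (Fin n × Fin n) (Fin n × Fin n) ℂ where
  toFun C := Matrix.of fun p q => C (p.1, q.2) (q.1, p.2)
  map_add' C D := by ext; simp
  map_smul' c C := by ext; simp

theorem partialTranspose_apply (C : Matrix (Fin n × Fin n) (Fin n × Fin n) ℂ)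
    (p q : Fin n × Fin n) : partialTranspose C p q = C (p.1, q.2) (q.1, p.2) := rfl

theorem partialTranspose_partialTranspose (C : Matrix (Fin n × Fin n) (Fin n × Fin n) ℂ) :
    partialTranspose (partialTranspose C) = C := rfl

theorem isDecomposable_iff_choi {φ : Module.End ℂ (Matrix (Fin n) (Fin n) ℂ)} :
    IsDecomposable φ ↔ ∃ X Y : Matrix (Fin n × Fin n) (Fin n × Fin n) ℂ,
      X.PosSemidef ∧ Y.PosSemidef ∧ choi φ = X + partialTranspose Y := by
  have hT : ∀ ψ : Module.End ℂ (Matrix (Fin n) (Fin n) ℂ),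
      choi ((Matrix.transposeLinearEquiv (Fin n) (Fin n) ℂ ℂ).toLinearMap ∘ₗ ψ) =
        partialTranspose (choi ψ) := fun ψ => rfl
  simp only [IsDecomposable, IsCoCP, isCP_iff_posSemidef_choi, hT]
  constructor
  · rintro ⟨φ₁, φ₂, h₁, h₂, rfl⟩
    exact ⟨_, _, h₁, h₂, by rw [map_add, partialTranspose_partialTranspose]⟩
  · rintro ⟨X, Y, hX, hY, h⟩
    refine ⟨ofChoi X, ofChoi (partialTranspose Y), ?_, ?_, choi_injective ?_⟩
    · rwa [choi_ofChoi]
    · rwa [choi_ofChoi, partialTranspose_partialTranspose]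
    · rw [h, map_add, choi_ofChoi, choi_ofChoi]

end Choi

/-! ### Trace bounds and compactness for positive semidefinite matrices. -/

section PositiveSemidefinite

open scoped Matrix ComplexOrder
open Filter Topology

variable {m : Type*} [Fintype m]

theorem norm_apply_le_of_posSemidef {Y : Matrix m m ℂ} (h : Y.PosSemidef) (p q : m) :
    ‖Y p q‖ ≤ ((Y p p).re + (Y q q).re) / 2 := by
  obtain ⟨B, rfl⟩ := posSemidef_iff_exists_conjTranspose_mul_self.mp h
  have hd : ∀ r, ((Bᴴ * B) r r).re = ∑ k, ‖B k r‖ ^ 2 := by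
    intro r
    simp [Matrix.mul_apply, Complex.sq_norm, Complex.normSq_apply]
  rw [hd, hd, Matrix.mul_apply, ← Finset.sum_add_distrib, Finset.sum_div]
  refine (norm_sum_le _ _).trans (Finset.sum_le_sum fun k _ => ?_)
  rw [norm_mul, Matrix.conjTranspose_apply, norm_star]
  nlinarith [sq_nonneg (‖B k p‖ - ‖B k q‖)]

theorem re_diag_nonneg_of_posSemidef {Y : Matrix m m ℂ} (h : Y.PosSemidef) (p : m) :
    0 ≤ (Y p p).re := by
  have := norm_apply_le_of_posSemidef h p p
  linarith [norm_nonneg (Y p p)]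

theorem re_trace_eq_sum (Y : Matrix m m ℂ) : Y.trace.re = ∑ p, (Y p p).re := by
  simp [Matrix.trace]

theorem re_trace_nonneg_of_posSemidef {Y : Matrix m m ℂ} (h : Y.PosSemidef) :
    0 ≤ Y.trace.re := by
  rw [re_trace_eq_sum]
  exact Finset.sum_nonneg fun p _ => re_diag_nonneg_of_posSemidef h p

theorem norm_apply_le_re_trace {Y : Matrix m m ℂ} (h : Y.PosSemidef) (p q : m) :
    ‖Y p q‖ ≤ Y.trace.re := by
  have hd : ∀ r, (Y r r).re ≤ Y.trace.re := fun r => by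
    rw [re_trace_eq_sum]
    exact Finset.single_le_sum (f := fun p => (Y p p).re)
      (fun p _ => re_diag_nonneg_of_posSemidef h p) (Finset.mem_univ r)
  linarith [norm_apply_le_of_posSemidef h p q, hd p, hd q]

theorem isClosed_posSemidef : IsClosed {Y : Matrix m m ℂ | Y.PosSemidef} := by
  simp only [Matrix.posSemidef_iff_dotProduct_mulVec, Set.ofPred_and, Set.ofPred_forall]
  refine IsClosed.inter (isClosed_eq (by fun_prop) continuous_id)
    (isClosed_iInter fun x => isClosed_le continuous_const ?_)
  simp only [dotProduct, Matrix.mulVec]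
  fun_prop

open scoped Matrix.Norms.Elementwise in
theorem isCompact_posSemidef_re_trace_le (R : ℝ) :
    IsCompact {Y : Matrix m m ℂ | Y.PosSemidef ∧ Y.trace.re ≤ R} := by
  refine Metric.isCompact_of_isClosed_isBounded ?_ ?_
  · rw [Set.ofPred_and]
    refine isClosed_posSemidef.inter (isClosed_le ?_ continuous_const)
    exact Complex.continuous_re.comp (continuous_id.matrix_trace)
  · refine (Metric.isBounded_closedBall (x := 0) (r := max R 0)).subset ?_
    rintro Y ⟨hY, hR⟩
    rw [mem_closedBall_zero_iff, Matrix.norm_le_iff (le_max_right _ _)]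
    exact fun i j => (norm_apply_le_re_trace hY i j).trans (hR.trans (le_max_left _ _))

end PositiveSemidefinite

/-! ### Closed cones of compressed decomposable Choi matrices. -/

section Closedness

open scoped Matrix ComplexOrder
open Filter Topology

variable {n : ℕ}

theorem continuous_partialTranspose : Continuous (partialTranspose (n := n)) :=
  continuous_matrix fun p q => continuous_id.matrix_elem (p.1, q.2) (q.1, p.2)

theorem trace_partialTranspose (Y : Matrix (Fin n × Fin n) (Fin n × Fin n) ℂ) :
    (partialTranspose Y).trace = Y.trace := rfl

/-- Along a convergent sequence the total trace is bounded. By `hP` this bounds the traces of both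
`X` and `Y`, so a subsequence of the pairs converges. -/
theorem isClosed_posSemidef_add_compression (P : Matrix (Fin n × Fin n) (Fin n × Fin n) ℂ) {c : ℝ}
    (hc : 0 < c) (hP : ∀ Y : Matrix (Fin n × Fin n) (Fin n × Fin n) ℂ, Y.PosSemidef →
      c * Y.trace.re ≤ (P * partialTranspose Y * Pᴴ).trace.re) :
    IsClosed {Z | ∃ X Y : Matrix (Fin n × Fin n) (Fin n × Fin n) ℂ, X.PosSemidef ∧ Y.PosSemidef ∧
      Z = X + P * partialTranspose Y * Pᴴ} := by
  have : FirstCountableTopology (Matrix (Fin n × Fin n) (Fin n × Fin n) ℂ) :=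
    inferInstanceAs (FirstCountableTopology (Fin n × Fin n → Fin n × Fin n → ℂ))
  refine IsSeqClosed.isClosed fun Z Z₀ hZ hlim => ?_
  choose X Y hX hY hXY using hZ
  have htr : Tendsto (fun k => (Z k).trace.re) atTop (𝓝 Z₀.trace.re) :=
    ((Complex.continuous_re.comp continuous_id.matrix_trace).tendsto Z₀).comp hlim
  obtain ⟨R, hR⟩ := htr.bddAbove_range
  have hR' : ∀ k, (X k).trace.re + (P * partialTranspose (Y k) * Pᴴ).trace.re ≤ R := fun k => by
    have := hR (Set.mem_range_self k)
    simpa only [hXY, Matrix.trace_add, Complex.add_re] using this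
  have hmem : ∀ k, (X k, Y k) ∈ {X : Matrix (Fin n × Fin n) (Fin n × Fin n) ℂ |
      X.PosSemidef ∧ X.trace.re ≤ R} ×ˢ {Y : Matrix (Fin n × Fin n) (Fin n × Fin n) ℂ |
      Y.PosSemidef ∧ Y.trace.re ≤ R / c} := fun k => by
    have h₁ := re_trace_nonneg_of_posSemidef (hX k)
    have h₂ := re_trace_nonneg_of_posSemidef (hY k)
    have h₃ := hP _ (hY k)
    have h₄ := hR' k
    have h₅ := mul_nonneg hc.le h₂
    refine ⟨⟨hX k, by linarith⟩, hY k, ?_⟩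
    rw [le_div_iff₀ hc]
    linarith
  obtain ⟨⟨X₀, Y₀⟩, ⟨hX₀, hY₀⟩, s, hs, hlim'⟩ :=
    ((isCompact_posSemidef_re_trace_le R).prod
      (isCompact_posSemidef_re_trace_le (R / c))).tendsto_subseq hmem
  refine ⟨X₀, Y₀, hX₀.1, hY₀.1, tendsto_nhds_unique (hlim.comp hs.tendsto_atTop) ?_⟩
  have hcont : Continuous fun W : Matrix (Fin n × Fin n) (Fin n × Fin n) ℂ ×
      Matrix (Fin n × Fin n) (Fin n × Fin n) ℂ => W.1 + P * partialTranspose W.2 * Pᴴ := by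
    have := continuous_partialTranspose (n := n)
    fun_prop
  refine ((hcont.tendsto _).comp hlim').congr fun k => ?_
  simp [hXY]

theorem isClosed_choi_isDecomposable :
    IsClosed {Z | ∃ X Y : Matrix (Fin n × Fin n) (Fin n × Fin n) ℂ, X.PosSemidef ∧ Y.PosSemidef ∧
      Z = X + partialTranspose Y} := by
  simpa using isClosed_posSemidef_add_compression (1 : Matrix (Fin n × Fin n) (Fin n × Fin n) ℂ)
    one_pos fun Y _ => by simp [trace_partialTranspose]

/-- The unnormalized maximally entangled vector. -/
def entangledVec (n : ℕ) (p : Fin n × Fin n) : ℂ := if p.1 = p.2 then 1 else 0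

/-- The projection onto the orthogonal complement of the maximally entangled vector. -/
noncomputable def complProj (n : ℕ) : Matrix (Fin n × Fin n) (Fin n × Fin n) ℂ :=
  1 - (n : ℂ)⁻¹ • Matrix.vecMulVec (entangledVec n) (entangledVec n)

theorem conjTranspose_complProj : (complProj n)ᴴ = complProj n := by
  have h : star (entangledVec n) = entangledVec n := by
    ext p
    simp [entangledVec, apply_ite]
  rw [complProj, Matrix.conjTranspose_sub, Matrix.conjTranspose_smul, Matrix.conjTranspose_one,
    Matrix.conjTranspose_vecMulVec, h, star_inv₀, star_natCast]

theorem choi_one : choi (1 : Module.End ℂ (Matrix (Fin n) (Fin n) ℂ)) =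
    Matrix.vecMulVec (entangledVec n) (entangledVec n) := by
  ext p q
  simp [choi_apply, Matrix.vecMulVec_apply, entangledVec, Matrix.single_apply, ite_and]
  split_ifs <;> rfl

theorem entangledVec_dotProduct_self : entangledVec n ⬝ᵥ entangledVec n = n := by
  simp [dotProduct, entangledVec, Fintype.sum_prod_type]

theorem complProj_mulVec_entangledVec (hn : n ≠ 0) : complProj n *ᵥ entangledVec n = 0 := by
  rw [complProj, Matrix.sub_mulVec, Matrix.one_mulVec, Matrix.smul_mulVec,
    Matrix.vecMulVec_mulVec, entangledVec_dotProduct_self]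
  ext p
  simp only [Pi.sub_apply, Pi.smul_apply, MulOpposite.smul_eq_mul_unop, MulOpposite.unop_op,
    smul_eq_mul, Pi.zero_apply]
  field_simp
  ring

theorem complProj_mul_self (hn : n ≠ 0) : complProj n * complProj n = complProj n := by
  conv_lhs => rw [complProj.eq_def]
  conv_lhs => rw [mul_sub, mul_one, mul_smul_comm, ← complProj, Matrix.mul_vecMulVec]
  rw [complProj_mulVec_entangledVec hn, Matrix.zero_vecMulVec, smul_zero, sub_zero]

theorem complProj_mul_choi_one (hn : n ≠ 0) : complProj n * choi 1 = 0 := by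
  rw [choi_one, Matrix.mul_vecMulVec, complProj_mulVec_entangledVec hn, Matrix.zero_vecMulVec]

/-- The compression loses `n⁻¹ ⟨Ω, partialTranspose Y Ω⟩`, which is `n⁻¹` times the trace of `Y`
against the flip, at most `n⁻¹ tr Y`. The constant is positive once `n ≥ 2`. -/
theorem le_re_trace_complProj_compression (hn : n ≠ 0)
    {Y : Matrix (Fin n × Fin n) (Fin n × Fin n) ℂ} (hY : Y.PosSemidef) :
    (1 - (n : ℝ)⁻¹) * Y.trace.re ≤
      (complProj n * partialTranspose Y * (complProj n)ᴴ).trace.re := by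
  rw [conjTranspose_complProj, Matrix.trace_mul_comm, ← mul_assoc, complProj_mul_self hn, complProj,
    Matrix.sub_mul, Matrix.one_mul, Matrix.trace_sub, trace_partialTranspose, smul_mul_assoc, Matrix.trace_smul,
    Complex.sub_re, sub_mul, one_mul, smul_eq_mul]
  have h₁ : (Matrix.vecMulVec (entangledVec n) (entangledVec n) * partialTranspose Y).trace =
      ∑ i, ∑ j, Y (i, j) (j, i) := by
    simp [Matrix.vecMulVec_mul, Matrix.trace_vecMulVec, dotProduct, Matrix.vecMul, entangledVec,
      partialTranspose_apply, Fintype.sum_prod_type]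
    exact Finset.sum_comm
  have h₂ : (∑ i, ∑ j, Y (i, j) (j, i)).re ≤ Y.trace.re := by
    have h₃ : Y.trace.re = ∑ i, ∑ j, ((Y (i, j) (i, j)).re + (Y (j, i) (j, i)).re) / 2 := by
      simp only [add_div, Finset.sum_add_distrib]
      rw [Finset.sum_comm (f := fun i j => (Y (j, i) (j, i)).re / 2), re_trace_eq_sum,
        Fintype.sum_prod_type]
      simp only [← Finset.sum_div]
      ring
    rw [h₃]
    simp only [Complex.re_sum]
    exact Finset.sum_le_sum fun i _ => Finset.sum_le_sum fun j _ =>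
      (Complex.re_le_norm _).trans (norm_apply_le_of_posSemidef hY _ _)
  rw [h₁, show ((n : ℂ)⁻¹ * ∑ i, ∑ j, Y (i, j) (j, i)).re =
    (n : ℝ)⁻¹ * (∑ i, ∑ j, Y (i, j) (j, i)).re by
      rw [show ((n : ℂ)⁻¹) = (((n : ℝ)⁻¹ : ℝ) : ℂ) by push_cast; rfl, Complex.re_ofReal_mul]]
  have : 0 ≤ (n : ℝ)⁻¹ := by positivity
  gcongr

end Closedness

/-! ### Splitting the generator into a decomposable map and a dissipation. -/

section Generator

open scoped Matrix ComplexOrder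
open Filter Topology

variable {n : ℕ}

theorem tendsto_exp_smul_slope {E : Type*} [NormedAddCommGroup E] [NormedSpace ℂ E]
    [CompleteSpace E] (T : E →L[ℂ] E) (x : E) :
    Tendsto (fun t : ℝ => (t : ℂ)⁻¹ • (NormedSpace.exp (t • T) x - x)) (𝓝[>] 0) (𝓝 (T x)) := by
  have h := hasDerivAt_exp_smul_const (𝕂 := ℝ) T (0 : ℝ)
  rw [zero_smul, NormedSpace.exp_zero, one_mul] at h
  have h' := hasDerivAt_iff_tendsto_slope_zero.mp h
  have h'' := (ContinuousLinearMap.apply ℂ E x).continuous.tendsto T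
  refine ((h''.comp h').mono_left (nhdsWithin_mono _ fun t ht => ne_of_gt ht)).congr fun t => ?_
  simp [← Complex.coe_smul]

open scoped Matrix.Norms.L2Operator in
theorem tendsto_semigroup_slope (L : Module.End ℂ (Matrix (Fin n) (Fin n) ℂ))
    (A : Matrix (Fin n) (Fin n) ℂ) :
    Tendsto (fun t : ℝ => (t : ℂ)⁻¹ • (semigroup L t A - A)) (𝓝[>] 0) (𝓝 (L A)) :=
  tendsto_exp_smul_slope (LinearMap.toContinuousLinearMap L) A

theorem tendsto_choi_semigroup_slope (L : Module.End ℂ (Matrix (Fin n) (Fin n) ℂ)) :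
    Tendsto (fun t : ℝ => (t : ℂ)⁻¹ • (choi (semigroup L t) - choi 1)) (𝓝[>] 0)
      (𝓝 (choi L)) := by
  refine tendsto_pi_nhds.mpr fun p => tendsto_pi_nhds.mpr fun q => ?_
  exact ((continuous_id.matrix_elem p.2 q.2).tendsto _).comp
    (tendsto_semigroup_slope L (Matrix.single p.1 q.1 1))

theorem trace_generator {L : Module.End ℂ (Matrix (Fin n) (Fin n) ℂ)}
    (hL : GeneratesDecomposableTPSemigroup L) (A : Matrix (Fin n) (Fin n) ℂ) :
    (L A).trace = 0 := by
  have h := ((continuous_id.matrix_trace).tendsto _).comp (tendsto_semigroup_slope L A)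
  refine tendsto_nhds_unique h (tendsto_const_nhds.congr' ?_)
  filter_upwards [self_mem_nhdsWithin] with t ht
  simp [Matrix.trace_smul, Matrix.trace_sub, (hL t (le_of_lt ht)).2 A]

theorem IsDecomposable.isHermitian_choi {φ : Module.End ℂ (Matrix (Fin n) (Fin n) ℂ)}
    (h : IsDecomposable φ) : (choi φ).IsHermitian := by
  obtain ⟨X, Y, hX, hY, h⟩ := isDecomposable_iff_choi.mp h
  rw [h]
  refine hX.1.add (Matrix.IsHermitian.ext fun p q => ?_)
  rw [partialTranspose_apply, partialTranspose_apply]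
  exact hY.1.apply _ _

theorem isHermitian_choi_one : (choi (1 : Module.End ℂ (Matrix (Fin n) (Fin n) ℂ))).IsHermitian := by
  refine Matrix.IsHermitian.ext fun p q => ?_
  by_cases hp : p.1 = p.2 <;> by_cases hq : q.1 = q.2 <;>
    simp [choi_one, Matrix.vecMulVec_apply, entangledVec, hp, hq]

theorem isHermitian_choi_generator {L : Module.End ℂ (Matrix (Fin n) (Fin n) ℂ)}
    (hL : GeneratesDecomposableTPSemigroup L) : (choi L).IsHermitian := by
  have hcl : IsClosed {M : Matrix (Fin n × Fin n) (Fin n × Fin n) ℂ | M.IsHermitian} :=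
    isClosed_eq (by fun_prop) continuous_id
  refine hcl.mem_of_tendsto (tendsto_choi_semigroup_slope L) ?_
  filter_upwards [self_mem_nhdsWithin] with t ht
  have h := (hL t (le_of_lt ht)).1.isHermitian_choi.sub isHermitian_choi_one
  rw [Matrix.IsHermitian, Matrix.conjTranspose_smul, h.eq, star_inv₀]
  simp

/-- Expanding `P M P = 0` expresses `M` through `w = M Ω` and the number `r = ⟨Ω, w⟩`, which is real
as `M` is Hermitian. -/
theorem eq_vecMulVec_add_of_compression_eq_zero
    {M : Matrix (Fin n × Fin n) (Fin n × Fin n) ℂ} (hM : M.IsHermitian)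
    (h : complProj n * M * complProj n = 0) :
    ∃ v : Fin n × Fin n → ℂ, M = Matrix.vecMulVec v (entangledVec n) +
      Matrix.vecMulVec (entangledVec n) (star v) := by
  set w := M *ᵥ entangledVec n with hw
  have hΩ : star (entangledVec n) = entangledVec n := by
    ext p
    simp [entangledVec, apply_ite]
  have hw' : entangledVec n ᵥ* M = star w := by
    rw [hw, Matrix.star_mulVec, hM.eq, hΩ]
  have hr : star (entangledVec n ⬝ᵥ w) = entangledVec n ⬝ᵥ w := by
    conv_rhs => rw [hw, Matrix.dotProduct_mulVec, hw', Matrix.star_dotProduct, hΩ]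
  set r := entangledVec n ⬝ᵥ w with hr_def
  have key : M = (n : ℂ)⁻¹ • Matrix.vecMulVec w (entangledVec n) +
      (n : ℂ)⁻¹ • Matrix.vecMulVec (entangledVec n) (star w) -
      ((n : ℂ)⁻¹ * (n : ℂ)⁻¹ * r) • Matrix.vecMulVec (entangledVec n) (entangledVec n) := by
    rw [complProj, Matrix.sub_mul, Matrix.one_mul, Matrix.mul_sub, Matrix.mul_one,
      Matrix.sub_mul, Matrix.smul_mul, Matrix.mul_smul, Matrix.mul_smul, Matrix.smul_mul,
      Matrix.vecMulVec_mul, Matrix.mul_vecMulVec, Matrix.vecMulVec_mul_vecMulVec, hw',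
      ← hw] at h
    have hr' : star w ⬝ᵥ entangledVec n = r := by rw [Matrix.star_dotProduct, hΩ, hr]
    rw [hr'] at h
    ext p q
    have hpq := congrFun (congrFun h p) q
    simp only [Matrix.sub_apply, Matrix.add_apply, Matrix.smul_apply, Matrix.vecMulVec_apply,
      Pi.smul_apply, smul_eq_mul, Matrix.zero_apply] at hpq ⊢
    linear_combination hpq
  -- The `ΩΩᴴ` term is split evenly between `v` and its adjoint, whence the factor `1/2`; this needs
  -- `r` real.
  refine ⟨(n : ℂ)⁻¹ • w - ((n : ℂ)⁻¹ * (n : ℂ)⁻¹ * r / 2) • entangledVec n, ?_⟩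
  conv_lhs => rw [key]
  ext p q
  have hΩ' := fun p => congrFun hΩ p
  simp only [Pi.star_apply, RCLike.star_def] at hΩ' hr
  simp [Matrix.vecMulVec_apply, hΩ', hr]
  ring

/-- The real-linear map sending `K` to the map `A ↦ K A + A Kᴴ`. -/
def dissipation : Matrix (Fin n) (Fin n) ℂ →ₗ[ℝ] Module.End ℂ (Matrix (Fin n) (Fin n) ℂ) where
  toFun K :=
    { toFun A := K * A + A * Kᴴ
      map_add' A B := by noncomm_ring
      map_smul' c A := by simp }
  map_add' K K' := by
    ext1 A
    simp only [Matrix.conjTranspose_add, LinearMap.coe_mk, AddHom.coe_mk, LinearMap.add_apply]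
    noncomm_ring
  map_smul' c K := by ext1 A; simp

theorem dissipation_apply (K A : Matrix (Fin n) (Fin n) ℂ) :
    dissipation K A = K * A + A * Kᴴ := rfl

theorem choi_dissipation (K : Matrix (Fin n) (Fin n) ℂ) :
    choi (dissipation K) = Matrix.vecMulVec (fun p => K p.2 p.1) (entangledVec n) +
      Matrix.vecMulVec (entangledVec n) (star fun p => K p.2 p.1) := by
  ext ⟨i, a⟩ ⟨j, b⟩
  simp [choi_apply, dissipation_apply, Matrix.vecMulVec_apply, entangledVec, Matrix.mul_apply,
    Matrix.single_apply, ite_and]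

theorem exists_isDecomposable_sub_dissipation {L : Module.End ℂ (Matrix (Fin n) (Fin n) ℂ)}
    (hL : GeneratesDecomposableTPSemigroup L) :
    ∃ K, IsDecomposable (L - dissipation K) := by
  rcases Nat.lt_or_ge 1 n with hn | hn
  swap
  -- For `n ≤ 1` a trace-annihilating map is zero. The case `n = 1` must be separate: there the
  -- constant `1 - n⁻¹` vanishes.
  · have : Subsingleton (Fin n) := by rw [Fin.subsingleton_iff_le_one]; exact hn
    refine ⟨0, isDecomposable_iff_choi.mpr
      ⟨0, 0, Matrix.PosSemidef.zero, Matrix.PosSemidef.zero, ?_⟩⟩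
    have h : L = 0 := by
      ext1 A
      ext i j
      have := trace_generator hL A
      rw [Matrix.trace, Fintype.sum_subsingleton _ i, Matrix.diag_apply] at this
      rwa [← Subsingleton.elim i j]
    simp [h]
  have hn0 : n ≠ 0 := by omega
  have hc : 0 < 1 - (n : ℝ)⁻¹ := by
    have : (1 : ℝ) < n := by exact_mod_cast hn
    linarith [inv_lt_one_of_one_lt₀ this]
  have hcl := isClosed_posSemidef_add_compression (complProj n) hc
    fun Y hY => le_re_trace_complProj_compression hn0 hY
  have hcont : Continuous fun M => complProj n * M * (complProj n)ᴴ := by fun_prop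
  obtain ⟨X, Y, hX, hY, hXY⟩ := hcl.mem_of_tendsto
    ((hcont.tendsto _).comp (tendsto_choi_semigroup_slope L)) (by
      filter_upwards [self_mem_nhdsWithin] with t ht
      obtain ⟨X, Y, hX, hY, h⟩ := isDecomposable_iff_choi.mp (hL t (le_of_lt ht)).1
      have ht' : (0 : ℂ) ≤ (t : ℂ)⁻¹ := by
        rw [← Complex.ofReal_inv]
        exact_mod_cast inv_nonneg.mpr (le_of_lt ht)
      refine ⟨_, _, (hX.smul ht').mul_mul_conjTranspose_same (complProj n), hY.smul ht', ?_⟩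
      simp only [Function.comp_apply, h]
      rw [Matrix.mul_smul, mul_sub, complProj_mul_choi_one hn0, sub_zero, map_smul]
      simp only [Matrix.mul_smul, Matrix.smul_mul, mul_add, add_mul, smul_add])
  have hdec : IsDecomposable (ofChoi (X + partialTranspose Y)) :=
    isDecomposable_iff_choi.mpr ⟨X, Y, hX, hY, choi_ofChoi _⟩
  -- Compressing `hXY` by `P` once more replaces `X` by `P X P`, so `X` itself may serve as the
  -- completely positive part.
  obtain ⟨v, hv⟩ := eq_vecMulVec_add_of_compression_eq_zero
    (M := choi (L - ofChoi (X + partialTranspose Y)))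
    (by rw [map_sub]; exact (isHermitian_choi_generator hL).sub hdec.isHermitian_choi) (by
      rw [conjTranspose_complProj] at hXY
      have hPP := complProj_mul_self hn0
      have h := congrArg (fun Z => complProj n * Z * complProj n) hXY
      simp only [mul_add, add_mul, ← mul_assoc, hPP] at h
      rw [mul_assoc _ (complProj n) (complProj n), mul_assoc _ (complProj n) (complProj n), hPP] at h
      rw [map_sub, choi_ofChoi, mul_sub, sub_mul, h, mul_add, add_mul, sub_self])
  refine ⟨Matrix.of fun a i => v (i, a), ?_⟩
  convert hdec using 1
  rw [sub_eq_iff_eq_add, ← sub_eq_iff_eq_add']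
  refine choi_injective ?_
  rw [hv, choi_dissipation]
  rfl

end Generator

/-! ### A commuting choice of `K` by norm minimization, and the resulting form of `L`. -/

section Invariance

open scoped Matrix ComplexOrder

variable {n : ℕ}

/-- The map `A ↦ V φ(Wᴴ A W) Vᴴ`. -/
def conjugate (V W : Matrix (Fin n) (Fin n) ℂ) (φ : Module.End ℂ (Matrix (Fin n) (Fin n) ℂ)) :
    Module.End ℂ (Matrix (Fin n) (Fin n) ℂ) where
  toFun A := V * φ (Wᴴ * A * W) * Vᴴ
  map_add' A B := by simp [mul_add, add_mul]
  map_smul' c A := by simp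

theorem conjugate_apply (V W : Matrix (Fin n) (Fin n) ℂ)
    (φ : Module.End ℂ (Matrix (Fin n) (Fin n) ℂ)) (A : Matrix (Fin n) (Fin n) ℂ) :
    conjugate V W φ A = V * φ (Wᴴ * A * W) * Vᴴ := rfl

theorem IsCP.conjugate {φ : Module.End ℂ (Matrix (Fin n) (Fin n) ℂ)} (h : IsCP φ)
    (V W : Matrix (Fin n) (Fin n) ℂ) : IsCP (conjugate V W φ) := by
  obtain ⟨K, hK⟩ := exists_eq_sum_of_posSemidef_choi h.posSemidef_choi
  refine isCP_of_eq_sum (fun p => V * K p * Wᴴ) fun A => ?_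
  rw [conjugate_apply, hK, Finset.mul_sum, Finset.sum_mul]
  refine Finset.sum_congr rfl fun p _ => ?_
  simp only [Matrix.conjTranspose_mul, Matrix.conjTranspose_conjTranspose, mul_assoc]

theorem IsDecomposable.conjugate {φ : Module.End ℂ (Matrix (Fin n) (Fin n) ℂ)}
    (h : IsDecomposable φ) (V W : Matrix (Fin n) (Fin n) ℂ) :
    IsDecomposable (conjugate V W φ) := by
  obtain ⟨φ₁, φ₂, h₁, h₂, rfl⟩ := h
  refine ⟨_, CovariantDecomposable.conjugate V W φ₂, h₁.conjugate V W, ?_, ?_⟩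
  -- Transposing a conjugation by `V` gives conjugation by the entrywise conjugate `Vᴴᵀ`.
  · have := IsCP.conjugate h₂ Vᴴᵀ W
    rw [IsCoCP]
    convert this using 1
    ext1 A
    have hV : Vᴴᵀᴴ = Vᵀ := by
      ext
      simp
    change (V * φ₂ (Wᴴ * A * W) * Vᴴ)ᵀ = Vᴴᵀ * (φ₂ (Wᴴ * A * W))ᵀ * Vᴴᵀᴴ
    rw [Matrix.transpose_mul, Matrix.transpose_mul, hV, ← mul_assoc]
  · ext1 A
    simp [conjugate_apply, mul_add, add_mul]

/-- Midpoint convexity is all that uniqueness of the norm minimizer requires. -/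
theorem IsDecomposable.half_add {φ ψ : Module.End ℂ (Matrix (Fin n) (Fin n) ℂ)}
    (hφ : IsDecomposable φ) (hψ : IsDecomposable ψ) :
    IsDecomposable ((1 / 2 : ℝ) • (φ + ψ)) := by
  obtain ⟨X, Y, hX, hY, h⟩ := isDecomposable_iff_choi.mp hφ
  obtain ⟨X', Y', hX', hY', h'⟩ := isDecomposable_iff_choi.mp hψ
  have h0 : (0 : ℂ) ≤ ((1 / 2 : ℝ) : ℂ) := by exact_mod_cast one_half_pos.le
  refine isDecomposable_iff_choi.mpr ⟨((1 / 2 : ℝ) : ℂ) • (X + X'), ((1 / 2 : ℝ) : ℂ) • (Y + Y'),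
    (hX.add hX').smul h0, (hY.add hY').smul h0, ?_⟩
  have hsmul : (1 / 2 : ℝ) • (φ + ψ) = ((1 / 2 : ℝ) : ℂ) • (φ + ψ) := by
    ext1 A
    exact (Complex.coe_smul _ _).symm
  rw [hsmul, map_smul, map_add, h, h', map_smul, map_add]
  module

theorem isClosed_isDecomposable_sub_dissipation (L : Module.End ℂ (Matrix (Fin n) (Fin n) ℂ)) :
    IsClosed {K | IsDecomposable (L - dissipation K)} := by
  simp only [isDecomposable_iff_choi]
  refine isClosed_choi_isDecomposable.preimage
    (f := fun K : Matrix (Fin n) (Fin n) ℂ => choi (L - dissipation K)) ?_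
  simp only [map_sub, choi_dissipation]
  refine continuous_const.sub (continuous_matrix fun p q => ?_)
  simp only [Matrix.add_apply, Matrix.vecMulVec_apply, Pi.star_apply]
  fun_prop

/-- The square of the Hilbert-Schmidt norm. -/
noncomputable def hsSq (K : Matrix (Fin n) (Fin n) ℂ) : ℝ := ∑ i, ∑ j, Complex.normSq (K i j)

theorem hsSq_eq_trace (K : Matrix (Fin n) (Fin n) ℂ) : hsSq K = (K * Kᴴ).trace.re := by
  simp [hsSq, Matrix.trace, Matrix.mul_apply, Complex.normSq_apply]

theorem normSq_le_hsSq (K : Matrix (Fin n) (Fin n) ℂ) (i j : Fin n) :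
    Complex.normSq (K i j) ≤ hsSq K :=
  (Finset.single_le_sum (f := fun j => Complex.normSq (K i j))
    (fun _ _ => Complex.normSq_nonneg _) (Finset.mem_univ j)).trans
  (Finset.single_le_sum (f := fun i => ∑ j, Complex.normSq (K i j))
    (fun _ _ => Finset.sum_nonneg fun _ _ => Complex.normSq_nonneg _) (Finset.mem_univ i))

theorem continuous_hsSq : Continuous (hsSq (n := n)) :=
  continuous_finsetSum _ fun _ _ => continuous_finsetSum _ fun _ _ =>
    Complex.continuous_normSq.comp (continuous_id.matrix_elem _ _)

/-- Parallelogram law, arranged so that the midpoint of two minimizers bounds their distance. -/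
theorem hsSq_sub (K K' : Matrix (Fin n) (Fin n) ℂ) :
    hsSq (K - K') = 2 * hsSq K + 2 * hsSq K' - 4 * hsSq ((1 / 2 : ℝ) • (K + K')) := by
  simp only [hsSq, Finset.mul_sum, ← Finset.sum_add_distrib, ← Finset.sum_sub_distrib]
  refine Finset.sum_congr rfl fun i _ => Finset.sum_congr rfl fun j _ => ?_
  simp [Complex.normSq_apply]
  ring

open scoped Matrix.Norms.Elementwise in
theorem exists_hsSq_minimal {S : Set (Matrix (Fin n) (Fin n) ℂ)} (hS : IsClosed S)
    (hne : S.Nonempty) : ∃ K ∈ S, ∀ K' ∈ S, hsSq K ≤ hsSq K' := by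
  obtain ⟨K₁, hK₁⟩ := hne
  have hcomp : IsCompact (S ∩ {K | hsSq K ≤ hsSq K₁}) := by
    refine Metric.isCompact_of_isClosed_isBounded
      (hS.inter (isClosed_le continuous_hsSq continuous_const)) ?_
    refine (Metric.isBounded_closedBall (x := 0) (r := √(hsSq K₁))).subset ?_
    rintro K ⟨-, hK⟩
    rw [mem_closedBall_zero_iff, Matrix.norm_le_iff (Real.sqrt_nonneg _)]
    refine fun i j => Real.le_sqrt_of_sq_le ?_
    rw [Complex.sq_norm]
    exact (normSq_le_hsSq K i j).trans hK
  obtain ⟨K, hK, hmin⟩ := hcomp.exists_isMinOn ⟨K₁, hK₁, le_refl (hsSq K₁)⟩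
    continuous_hsSq.continuousOn
  refine ⟨K, hK.1, fun K' hK' => ?_⟩
  rcases le_total (hsSq K') (hsSq K₁) with h | h
  · exact hmin ⟨hK', h⟩
  · exact hK.2.trans h

theorem eq_of_hsSq_minimal {S : Set (Matrix (Fin n) (Fin n) ℂ)}
    (hS : ∀ K ∈ S, ∀ K' ∈ S, (1 / 2 : ℝ) • (K + K') ∈ S) {K K' : Matrix (Fin n) (Fin n) ℂ}
    (hK : K ∈ S) (hmin : ∀ K' ∈ S, hsSq K ≤ hsSq K') (hK' : K' ∈ S) (h : hsSq K' = hsSq K) :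
    K' = K := by
  have h₁ := hmin _ (hS K hK K' hK')
  have h₂ := hsSq_sub K K'
  have h₃ : hsSq (K - K') ≤ 0 := by linarith
  ext i j
  have h₄ := Complex.normSq_eq_zero.mp
    (le_antisymm ((normSq_le_hsSq (K - K') i j).trans h₃) (Complex.normSq_nonneg _))
  exact (sub_eq_zero.mp h₄).symm

variable {G : Type*} [Group G] {U : G →* Matrix.unitaryGroup (Fin n) ℂ}

theorem conjTranspose_mul_unitary (g : G) :
    (U g : Matrix (Fin n) (Fin n) ℂ)ᴴ * (U g : Matrix (Fin n) (Fin n) ℂ) = 1 :=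
  Matrix.mem_unitaryGroup_iff'.mp (U g).2

theorem unitary_mul_conjTranspose (g : G) :
    (U g : Matrix (Fin n) (Fin n) ℂ) * (U g : Matrix (Fin n) (Fin n) ℂ)ᴴ = 1 :=
  Matrix.mem_unitaryGroup_iff.mp (U g).2

theorem IsCovariant.conjugate_eq {φ : Module.End ℂ (Matrix (Fin n) (Fin n) ℂ)}
    (h : IsCovariant U φ) (g : G) : conjugate (U g) (U g) φ = φ := by
  ext1 A
  rw [conjugate_apply, ← h]
  congr 1
  calc _ = ((U g : Matrix (Fin n) (Fin n) ℂ) * (U g : Matrix (Fin n) (Fin n) ℂ)ᴴ) * A *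
        ((U g : Matrix (Fin n) (Fin n) ℂ) * (U g : Matrix (Fin n) (Fin n) ℂ)ᴴ) := by
          simp only [mul_assoc]
    _ = A := by rw [unitary_mul_conjTranspose, one_mul, mul_one]

theorem conjugate_dissipation (g : G) (K : Matrix (Fin n) (Fin n) ℂ) :
    conjugate (U g) (U g) (dissipation K) =
      dissipation ((U g : Matrix (Fin n) (Fin n) ℂ) * K * (U g : Matrix (Fin n) (Fin n) ℂ)ᴴ) := by
  ext1 A
  set V := (U g : Matrix (Fin n) (Fin n) ℂ) with hV
  have h : V * Vᴴ = 1 := unitary_mul_conjTranspose g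
  rw [conjugate_apply, dissipation_apply, dissipation_apply, mul_add, add_mul]
  congr 1
  · calc _ = V * K * Vᴴ * A * (V * Vᴴ) := by simp only [mul_assoc]
      _ = _ := by rw [h, mul_one]
  · calc _ = (V * Vᴴ) * A * (V * Kᴴ * Vᴴ) := by simp only [mul_assoc]
      _ = _ := by
        rw [h, one_mul, Matrix.conjTranspose_mul, Matrix.conjTranspose_mul,
          Matrix.conjTranspose_conjTranspose, mul_assoc V]

theorem hsSq_conj (g : G) (K : Matrix (Fin n) (Fin n) ℂ) :
    hsSq ((U g : Matrix (Fin n) (Fin n) ℂ) * K * (U g : Matrix (Fin n) (Fin n) ℂ)ᴴ) = hsSq K := by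
  set V := (U g : Matrix (Fin n) (Fin n) ℂ) with hV
  have h : Vᴴ * V = 1 := conjTranspose_mul_unitary g
  rw [hsSq_eq_trace, hsSq_eq_trace]
  congr 1
  calc _ = (V * (K * (Vᴴ * V) * Kᴴ * Vᴴ)).trace := by
        simp only [Matrix.conjTranspose_mul, Matrix.conjTranspose_conjTranspose, mul_assoc]
    _ = (K * Kᴴ * (Vᴴ * V)).trace := by
        rw [Matrix.trace_mul_comm, h, mul_one, mul_assoc, h]
    _ = _ := by rw [h, mul_one]

/-- Conjugation by `U g` maps the minimizer to an admissible matrix of equal norm, hence to itself.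
-/
theorem exists_commuting_isDecomposable_sub_dissipation
    {L : Module.End ℂ (Matrix (Fin n) (Fin n) ℂ)}
    (hL : GeneratesDecomposableTPSemigroup L) (hcov : IsCovariant U L) :
    ∃ K, IsDecomposable (L - dissipation K) ∧
      ∀ g, (U g : Matrix (Fin n) (Fin n) ℂ) * K * (U g : Matrix (Fin n) (Fin n) ℂ)ᴴ = K := by
  obtain ⟨K, hK, hmin⟩ := exists_hsSq_minimal (isClosed_isDecomposable_sub_dissipation L)
    (exists_isDecomposable_sub_dissipation hL)
  refine ⟨K, hK, fun g => eq_of_hsSq_minimal (fun K hK K' hK' => ?_) hK hmin ?_ (hsSq_conj g K)⟩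
  · have h := IsDecomposable.half_add hK hK'
    rw [Set.mem_ofPred_eq]
    convert h using 1
    rw [map_smul, map_add]
    module
  · have h := IsDecomposable.conjugate hK (U g) (U g)
    rw [Set.mem_ofPred_eq]
    convert h using 1
    rw [← conjugate_dissipation]
    nth_rewrite 1 [← hcov.conjugate_eq g]
    ext1 A
    simp [conjugate_apply, mul_sub, sub_mul]

/-- Pairing with `T`, the term `tr (L T)` vanishes, leaving `-tr (K T + T Kᴴ)`. -/
theorem dualMap_one_sub_dissipation {L : Module.End ℂ (Matrix (Fin n) (Fin n) ℂ)}
    (hL : ∀ A, (L A).trace = 0) (K : Matrix (Fin n) (Fin n) ℂ) :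
    dualMap (L - dissipation K) 1 = -(K + Kᴴ) := by
  refine Matrix.ext_iff_trace_mul_right.mpr fun T => ?_
  rw [trace_dualMap_mul, one_mul, LinearMap.sub_apply, Matrix.trace_sub, hL, dissipation_apply,
    Matrix.trace_add, Matrix.trace_mul_comm T, ← Matrix.trace_add, ← add_mul, neg_mul,
    Matrix.trace_neg, zero_sub]

theorem IsCovariant.dualMap_one_conj {φ : Module.End ℂ (Matrix (Fin n) (Fin n) ℂ)}
    (h : IsCovariant U φ) (g : G) :
    (U g : Matrix (Fin n) (Fin n) ℂ)ᴴ * dualMap φ 1 * (U g : Matrix (Fin n) (Fin n) ℂ) =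
      dualMap φ 1 := by
  set V := (U g : Matrix (Fin n) (Fin n) ℂ) with hV
  refine Matrix.ext_iff_trace_mul_right.mpr fun T => ?_
  calc _ = (dualMap φ 1 * (V * T * Vᴴ)).trace := by
        rw [mul_assoc, mul_assoc, Matrix.trace_mul_comm]
        simp only [mul_assoc]
    _ = (dualMap φ 1 * T).trace := by
        rw [trace_dualMap_mul, trace_dualMap_mul, h g, one_mul, one_mul, Matrix.trace_mul_comm,
          ← mul_assoc, conjTranspose_mul_unitary, one_mul]

theorem mul_comm_of_conj_eq {g : G} {K : Matrix (Fin n) (Fin n) ℂ}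
    (h : (U g : Matrix (Fin n) (Fin n) ℂ) * K * (U g : Matrix (Fin n) (Fin n) ℂ)ᴴ = K) :
    (U g : Matrix (Fin n) (Fin n) ℂ) * K = K * (U g : Matrix (Fin n) (Fin n) ℂ) := by
  conv_rhs => rw [← h]
  rw [mul_assoc _ _ (U g : Matrix (Fin n) (Fin n) ℂ), conjTranspose_mul_unitary, mul_one]

theorem conjTranspose_conj_eq {g : G} {K : Matrix (Fin n) (Fin n) ℂ}
    (h : (U g : Matrix (Fin n) (Fin n) ℂ) * K * (U g : Matrix (Fin n) (Fin n) ℂ)ᴴ = K) :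
    (U g : Matrix (Fin n) (Fin n) ℂ) * Kᴴ * (U g : Matrix (Fin n) (Fin n) ℂ)ᴴ = Kᴴ := by
  conv_rhs => rw [← h]
  simp [mul_assoc]

/-- Write `K` as Hermitian plus skew-Hermitian part: the former yields the anticommutator, the
latter equals `-i H`. -/
theorem hasForm_sub_dissipation {L : Module.End ℂ (Matrix (Fin n) (Fin n) ℂ)}
    (hL : ∀ A, (L A).trace = 0) (K : Matrix (Fin n) (Fin n) ℂ) :
    HasForm L ((Complex.I / 2) • (K - Kᴴ)) (L - dissipation K) := by
  intro A
  rw [dualMap_one_sub_dissipation hL, LinearMap.sub_apply, dissipation_apply]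
  simp only [Matrix.smul_mul, Matrix.mul_smul, ← smul_sub, smul_smul]
  rw [show -Complex.I * (Complex.I / 2) = 1 / 2 by
    rw [neg_mul, ← mul_div_assoc, Complex.I_mul_I]; norm_num]
  simp only [sub_mul, mul_sub, neg_mul, mul_neg, add_mul, mul_add]
  module

theorem isCovariant_dissipation {K : Matrix (Fin n) (Fin n) ℂ}
    (h : ∀ g, (U g : Matrix (Fin n) (Fin n) ℂ) * K * (U g : Matrix (Fin n) (Fin n) ℂ)ᴴ = K) :
    IsCovariant U (dissipation K) := by
  intro g A
  have h₁ := mul_comm_of_conj_eq (h g)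
  have h₂ := congrArg Matrix.conjTranspose h₁
  simp only [Matrix.conjTranspose_mul] at h₂
  rw [dissipation_apply, dissipation_apply, mul_add, add_mul, mul_assoc _ _ Kᴴ, ← h₂,
    ← mul_assoc K, ← mul_assoc K, ← h₁]
  simp only [mul_assoc]

/-- Both `H` and `dualMap φ 1` commute with `U g`, so left and right multiplication by them are
covariant. -/
theorem HasForm.isCovariant {L φ : Module.End ℂ (Matrix (Fin n) (Fin n) ℂ)}
    {H : Matrix (Fin n) (Fin n) ℂ} (hL : HasForm L H φ) (hφ : IsCovariant U φ)
    (hH : ∀ g, (U g : Matrix (Fin n) (Fin n) ℂ) * H = H * (U g : Matrix (Fin n) (Fin n) ℂ)) :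
    IsCovariant U L := by
  intro g A
  have hcomm : ∀ B : Matrix (Fin n) (Fin n) ℂ,
      (U g : Matrix (Fin n) (Fin n) ℂ) * B = B * (U g : Matrix (Fin n) (Fin n) ℂ) →
      B * ((U g : Matrix (Fin n) (Fin n) ℂ) * A * (U g : Matrix (Fin n) (Fin n) ℂ)ᴴ) =
        (U g : Matrix (Fin n) (Fin n) ℂ) * (B * A) * (U g : Matrix (Fin n) (Fin n) ℂ)ᴴ ∧
      (U g : Matrix (Fin n) (Fin n) ℂ) * A * (U g : Matrix (Fin n) (Fin n) ℂ)ᴴ * B =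
        (U g : Matrix (Fin n) (Fin n) ℂ) * (A * B) * (U g : Matrix (Fin n) (Fin n) ℂ)ᴴ := by
    intro B hB
    have hB' : (U g : Matrix (Fin n) (Fin n) ℂ)ᴴ * B = B * (U g : Matrix (Fin n) (Fin n) ℂ)ᴴ := by
      calc _ = (U g : Matrix (Fin n) (Fin n) ℂ)ᴴ * (B * (U g : Matrix (Fin n) (Fin n) ℂ)) *
            (U g : Matrix (Fin n) (Fin n) ℂ)ᴴ := by
              rw [mul_assoc, mul_assoc, unitary_mul_conjTranspose, mul_one]
        _ = _ := by rw [← hB, ← mul_assoc, conjTranspose_mul_unitary, one_mul]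
    constructor
    · rw [← mul_assoc, ← mul_assoc, ← hB]
      simp only [mul_assoc]
    · rw [mul_assoc, hB']
      simp only [mul_assoc]
  have hD : (U g : Matrix (Fin n) (Fin n) ℂ) * dualMap φ 1 =
      dualMap φ 1 * (U g : Matrix (Fin n) (Fin n) ℂ) := by
    conv_lhs => rw [← hφ.dualMap_one_conj g]
    rw [mul_assoc, ← mul_assoc, unitary_mul_conjTranspose, one_mul]
  rw [hL, hL, hφ, (hcomm H (hH g)).1, (hcomm H (hH g)).2, (hcomm _ hD).1, (hcomm _ hD).2]
  simp only [mul_add, add_mul, mul_sub, sub_mul, Matrix.mul_smul, Matrix.smul_mul]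

end Invariance

end CovariantDecomposable

theorem mainTheorem10 {G : Type*} [Group G] [TopologicalSpace G] [IsTopologicalGroup G]
    [CompactSpace G] (n : ℕ) (U : G →* Matrix.unitaryGroup (Fin n) ℂ) (hU : Continuous U)
    (L : Module.End ℂ (Matrix (Fin n) (Fin n) ℂ))
    (hL : CovariantDecomposable.GeneratesDecomposableTPSemigroup L) :
    CovariantDecomposable.IsCovariant U L ↔
      ∃ (H : Matrix (Fin n) (Fin n) ℂ) (φ : Module.End ℂ (Matrix (Fin n) (Fin n) ℂ)),
        H.IsHermitian ∧
        H ∈ Set.centralizer (Set.range fun g : G => (U g : Matrix (Fin n) (Fin n) ℂ)) ∧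
        CovariantDecomposable.IsDecomposable φ ∧
        CovariantDecomposable.IsCovariant U φ ∧
        CovariantDecomposable.HasForm L H φ := by
  open CovariantDecomposable in
  constructor
  · intro hcov
    obtain ⟨K, hK, hKU⟩ := exists_commuting_isDecomposable_sub_dissipation hL hcov
    refine ⟨(Complex.I / 2) • (K - K.conjTranspose), L - dissipation K, ?_, ?_, hK, ?_,
      hasForm_sub_dissipation (trace_generator hL) K⟩
    · rw [Matrix.IsHermitian, Matrix.conjTranspose_smul, Matrix.conjTranspose_sub,
        Matrix.conjTranspose_conjTranspose, ← neg_sub K, smul_neg, ← neg_smul]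
      simp [neg_div]
    · rintro _ ⟨g, rfl⟩
      have h₁ := mul_comm_of_conj_eq (hKU g)
      have h₂ := mul_comm_of_conj_eq (conjTranspose_conj_eq (hKU g))
      simp only [Matrix.mul_smul, Matrix.smul_mul, mul_sub, sub_mul, h₁, h₂]
    · intro g A
      rw [LinearMap.sub_apply, LinearMap.sub_apply, hcov, isCovariant_dissipation hKU, mul_sub,
        sub_mul]
  · rintro ⟨H, φ, -, hH, -, hφ, hform⟩
    exact hform.isCovariant hφ fun g => hH _ ⟨g, rfl⟩
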